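/- Let $\varepsilon\in\{1,-1\}$ and let $(M,g_M)$ be a smooth Lorentzian manifold of dimension $2n+1$ with a smooth $(1,1)$-tensor field $\phi$, a smooth vector field $\xi$ and a smooth $1$-form $\eta$ such that, for all vector fields $X,Y$, $$\phi^2X=\varepsilon X+\eta(X)\xi,\quad g_M(\phi X,\phi Y)=g_M(X,Y)+\eta(X)\eta(Y),\quad \eta(X)=\varepsilon g_M(X,\xi),\quad \eta(\xi)=-\varepsilon,$$ $$(\nabla_X\phi)Y=\varepsilon\, g_M(\phi X,\phi Y)\,\xi+\eta(Y)\,\phi^2X,$$ where $\nabla$ is the Levi-Civita connection of $g_M$; that is, $M$ is Lorentzian Sasakian if $\varepsilon=-1$ and Lorentzian para-Sasakian if $\varepsilon=1$. Let $F:M\to N$ be a semi-Riemannian submersion onto a Lorentzian manifold $(N,g_N)$: a smooth surjective submersion whose fibers are semi-Riemannian submanifolds and whose differential $F_*$ preserves scalar products of vectors normal to the fibers. Assume that $F$ is anti-invariant, i.e. $\phi(\ker F_*)\subseteq(\ker F_*)^\perp$, and that $\xi$ is horizontal, i.e. $\xi\in\Gamma((\ker F_*)^\perp)$. Let $\mathcal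 V,\mathcal H$ be the orthogonal projections of $TM$ onto $\ker F_*$ and $(\ker F_*)^\perp$. For vector fields $D,E$ on $M$ put $\mathcal A_DE=\mathcal V\nabla_{\mathcal HD}\mathcal HE+\mathcal H\nabla_{\mathcal HD}\mathcal VE$. For horizontal $X$ write $\phi X=BX+CX$ with $BX=\mathcal V\phi X$ and $CX=\mathcal H\phi X$. Let $(\nabla F_*)(D,E)=\nabla^F_DF_*E-F_*(\nabla_DE)$ be the second fundamental form of $F$, where $\nabla^F$ is the pullback to $F^{-1}TN$ of the Levi-Civita connection of $g_N$. Then the following assertions are equivalent. (i) $(\ker F_*)^\perp$ is integrable, i.e. $[X,Y]\in\Gamma((\ker F_*)^\perp)$ for all $X,Y\in\Gamma((\ker F_*)^\perp)$. (ii) For all $X,Y\in\Gamma((\ker F_*)^\perp)$ and $V\in\Gamma(\ker F_*)$, $$g_N\big((\nabla F_*)(Y,BX),F_*\phi V\big)=g_N\big((\nabla F_*)(X,BY),F_*\phi V\big)-g_M(CX,\phi\mathcal A_YV)+g_M(CY,\phi\mathcal A_XV)+\varepsilon g_M(X,\phi V)\eta(Y)-\varepsilon g_M(Y,\phi V)\eta(X).$$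 (iii) For all $X,Y\in\Gamma((\ker F_*)^\perp)$ and $V\in\Gamma(\ker F_*)$, $$\varepsilon\, g_M\big(\mathcal A_X\mathcal A_Y\xi-\mathcal A_Y\mathcal A_X\xi,\phi V\big)=-g_M(CX,\phi\mathcal A_YV)+g_M(CY,\phi\mathcal A_XV)+\varepsilon g_M(X,\phi V)\eta(Y)-\varepsilon g_M(Y,\phi V)\eta(X).$$ -/

import Mathlib

open Bundle Manifold FiberBundle VectorField
open scoped ContDiff

set_option linter.unusedSectionVars false

noncomputable section

namespace LorentzianSubmersion

section Metric

variable {E : Type*} [NormedAddCommGroup E] [NormedSpace ℝ E] [FiniteDimensional ℝ E]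
  {H : Type*} [TopologicalSpace H] (I : ModelWithCorners ℝ E H)
  (M : Type*) [TopologicalSpace M] [ChartedSpace H M] [IsManifold I ∞ M]

/-- A smooth metric tensor: a smooth field of nondegenerate symmetric bilinear forms on the tangent
spaces of `M`. -/
structure MetricTensor where
  /-- The scalar product on each tangent space. -/
  val (x : M) : TangentSpace I x →L[ℝ] TangentSpace I x →L[ℝ] ℝ
  symm (x : M) (v w : TangentSpace I x) : val x v w = val x w v
  nondegenerate (x : M) (v : TangentSpace I x) : (∀ w, val x v w = 0) → v = 0
  contMDiff : ContMDiff I (I.prod 𝓘(ℝ, E →L[ℝ] E →L[ℝ] ℝ)) ∞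
    (fun x ↦ TotalSpace.mk' (E →L[ℝ] E →L[ℝ] ℝ)
      (E := fun x : M ↦ TangentSpace I x →L[ℝ] TangentSpace I x →L[ℝ] ℝ) x (val x))

variable {I M}

namespace MetricTensor

variable (g : MetricTensor I M)

lemma mdifferentiableAt {x : M} {X Y : Π x : M, TangentSpace I x}
   (hX : MDiffAt (T% X) x) (hY : MDiffAt (T% Y) x) : MDiffAt (fun y ↦ g.val y (X y) (Y y)) x := by
  have : MDifferentiableAt I (I.prod 𝓘(ℝ)) 
      (fun m ↦ TotalSpace.mk' ℝ (E := Bundle.Trivial M ℝ) m (g.val m (X m) (Y m))) x := by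
    apply MDifferentiableAt.clm_bundle_apply₂ (F₁ := E) (F₂ := E) (b := id)
    · exact (g.contMDiff x).mdifferentiableAt (by simp)
    · exact hX
    · exact hY
  rw [mdifferentiableAt_totalSpace] at this
  exact this.2

/-- The expression for `g (∇_X Y, Z)` given by the Koszul formula. -/
def koszul (Y X Z : Π x : M, TangentSpace I x) (x : M) : ℝ :=
  (d% (fun y ↦ g.val y (Y y) (Z y)) x (X x) + d% (fun y ↦ g.val y (X y) (Z y)) x (Y x)
    - d% (fun y ↦ g.val y (X y) (Y y)) x (Z x)
    + g.val x (mlieBracket I X Y x) (Z x) - g.val x (mlieBracket I X Z x) (Y x)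
    - g.val x (mlieBracket I Y Z x) (X x)) / 2

lemma tensorial_koszul₁ {x : M} {Y Z : Π x : M, TangentSpace I x}
    (hY : MDiffAt (T% Y) x) (hZ : MDiffAt (T% Z) x) :
    TensorialAt I E (fun X ↦ g.koszul Y X Z x) x where
  smul {f X} hf hX := by
    have : IsManifold I 2 M := .of_le (n := ∞) (by norm_cast)
    have h1 := mvfderiv_fun_mul hf (g.mdifferentiableAt hX hZ)
    have h2 := mvfderiv_fun_mul hf (g.mdifferentiableAt hX hY)
    simp [koszul, h1, h2, mlieBracket_smul_left hf hX]
    rw [g.symm x (X x) (Z x), g.symm x (X x) (Y x)]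
    ring
  add {X X'} hX hX' := by
    have : IsManifold I 2 M := .of_le (n := ∞) (by norm_cast)
    have h1 := mvfderiv_fun_add (g.mdifferentiableAt hX hZ) (g.mdifferentiableAt hX' hZ)
    have h2 := mvfderiv_fun_add (g.mdifferentiableAt hX hY) (g.mdifferentiableAt hX' hY)
    simp [koszul, h1, h2, mlieBracket_add_left hX hX']
    ring

lemma tensorial_koszul₂ {x : M} {Y X : Π x : M, TangentSpace I x}
    (hY : MDiffAt (T% Y) x) (hX : MDiffAt (T% X) x) :
    TensorialAt I E (fun Z ↦ g.koszul Y X Z x) x where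
  smul {f Z} hf hZ := by
    have : IsManifold I 2 M := .of_le (n := ∞) (by norm_cast)
    have h1 := mvfderiv_fun_mul hf (g.mdifferentiableAt hX hZ)
    have h2 := mvfderiv_fun_mul hf (g.mdifferentiableAt hY hZ)
    simp [koszul, h1, h2, mlieBracket_smul_right hf hZ]
    rw [g.symm x (Z x) (X x), g.symm x (Z x) (Y x)]
    ring
  add {Z Z'} hZ hZ' := by
    have : IsManifold I 2 M := .of_le (n := ∞) (by norm_cast)
    have h1 := mvfderiv_fun_add (g.mdifferentiableAt hX hZ) (g.mdifferentiableAt hX hZ')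
    have h2 := mvfderiv_fun_add (g.mdifferentiableAt hY hZ) (g.mdifferentiableAt hY hZ')
    simp [koszul, h1, h2, mlieBracket_add_right hZ hZ']
    ring

/-- The metric as a linear isomorphism from the tangent space onto its dual. -/
def flat (x : M) : TangentSpace I x ≃L[ℝ] (TangentSpace I x →L[ℝ] ℝ) :=
  haveI : FiniteDimensional ℝ (TangentSpace I x) := inferInstanceAs (FiniteDimensional ℝ E)
  haveI : T2Space (TangentSpace I x) := inferInstanceAs (T2Space E)
  (LinearEquiv.ofInjectiveOfFinrankEq (g.val x : TangentSpace I x →ₗ[ℝ] TangentSpace I x →L[ℝ] ℝ)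
    ((injective_iff_map_eq_zero _).2 fun v hv ↦ g.nondegenerate x v fun w ↦ by
      simpa using congr($hv w))
    (by
      rw [← (LinearMap.toContinuousLinearMap (𝕜 := ℝ) (E := TangentSpace I x)
        (F' := ℝ)).finrank_eq]
      exact Subspace.dual_finrank_eq.symm)).toContinuousLinearEquiv

lemma flat_apply (x : M) (v : TangentSpace I x) : g.flat x v = g.val x v := rfl

open scoped Classical in
/-- `∇_v Y` at `x`: the vector whose scalar product with each `Z` is `koszul Y X Z`, where `X` extends
`v` (and `0` where `Y` is not differentiable). The argument order follows `CovariantDerivative`. -/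
def leviCivitaFun (Y : Π x : M, TangentSpace I x) (x : M) :
    TangentSpace I x →L[ℝ] TangentSpace I x :=
  if hY : MDiffAt (T% Y) x then
    (g.flat x).symm.toContinuousLinearMap ∘L
      TensorialAt.mkHom₂ (I := I) (F := E) (F' := E) (fun X Z ↦ g.koszul Y X Z x) x
        (fun _ hZ ↦ g.tensorial_koszul₁ hY hZ) (fun _ hX ↦ g.tensorial_koszul₂ hY hX)
  else 0

lemma val_leviCivitaFun {x : M} {X Y Z : Π x : M, TangentSpace I x}
    (hX : MDiffAt (T% X) x) (hY : MDiffAt (T% Y) x) (hZ : MDiffAt (T% Z) x) :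
    g.val x (g.leviCivitaFun Y x (X x)) (Z x) = g.koszul Y X Z x := by
  rw [← flat_apply, leviCivitaFun, dif_pos hY]
  simp only [ContinuousLinearMap.coe_comp, Function.comp_apply, ContinuousLinearEquiv.coe_coe,
    ContinuousLinearEquiv.apply_symm_apply]
  exact TensorialAt.mkHom₂_apply (I := I) (F := E) (F' := E) (Φ := fun X Z ↦ g.koszul Y X Z x)
    (fun _ hZ ↦ g.tensorial_koszul₁ hY hZ) (fun _ hX ↦ g.tensorial_koszul₂ hY hX) hX hZ

lemma eq_of_val_eq {x : M} {v w : TangentSpace I x} (h : ∀ z, g.val x v z = g.val x w z) :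
    v = w :=
  sub_eq_zero.1 (g.nondegenerate x _ fun z ↦ by simp [h z])

/-- The Levi-Civita connection of a metric tensor, constructed from the Koszul formula. -/
def leviCivita : CovariantDerivative I E (TangentSpace I : M → Type _) where
  toFun := g.leviCivitaFun
  isCovariantDerivativeOnUniv :=
    { add := by
        intro Y Y' x hY hY' _
        ext v
        refine g.eq_of_val_eq fun z ↦ ?_
        have : IsManifold I 2 M := .of_le (n := ∞) (by norm_cast)
        have hX := mdifferentiableAt_extend I E v
        have hZ := mdifferentiableAt_extend I E z
        have h := g.val_leviCivitaFun hX (mdifferentiableAt_add_section hY hY') hZ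
        have h' := g.val_leviCivitaFun hX hY hZ
        have h'' := g.val_leviCivitaFun hX hY' hZ
        have h1 := mvfderiv_fun_add (g.mdifferentiableAt hY hZ) (g.mdifferentiableAt hY' hZ)
        have h2 := mvfderiv_fun_add (g.mdifferentiableAt hX hY) (g.mdifferentiableAt hX hY')
        simp only [extend_apply_self] at h h' h''
        simp only [add_apply, map_add, h, h', h'']
        simp [koszul, h1, h2, mlieBracket_add_left hY hY', mlieBracket_add_right hY hY']
        ring
      leibniz := by
        intro Y f x hY hf _
        ext v
        refine g.eq_of_val_eq fun z ↦ ?_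
        have : IsManifold I 2 M := .of_le (n := ∞) (by norm_cast)
        have hX := mdifferentiableAt_extend I E v
        have hZ := mdifferentiableAt_extend I E z
        have h := g.val_leviCivitaFun hX (hf.smul_section hY) hZ
        have h' := g.val_leviCivitaFun hX hY hZ
        have h1 := mvfderiv_fun_mul hf (g.mdifferentiableAt hY hZ)
        have h2 := mvfderiv_fun_mul hf (g.mdifferentiableAt hX hY)
        simp only [extend_apply_self] at h h'
        simp only [add_apply, map_add, smul_apply, map_smul,
          h, h']
        simp [koszul, h1, h2, mlieBracket_smul_left hf hY, mlieBracket_smul_right hf hY]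
        rw [g.symm x v (Y x)]
        ring }

theorem leviCivita_torsionFree {x : M} {X Y : Π x : M, TangentSpace I x}
    (hX : MDiffAt (T% X) x) (hY : MDiffAt (T% Y) x) :
    g.leviCivita Y x (X x) - g.leviCivita X x (Y x) = mlieBracket I X Y x := by
  refine g.eq_of_val_eq fun z ↦ ?_
  have hZ := mdifferentiableAt_extend I E z
  have h := g.val_leviCivitaFun hX hY hZ
  have h' := g.val_leviCivitaFun hY hX hZ
  simp only [extend_apply_self] at h h'
  simp only [map_sub, sub_apply, leviCivita, h, h']
  have e : (fun y ↦ g.val y (X y) (Y y)) = fun y ↦ g.val y (Y y) (X y) := by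
    ext y; exact g.symm _ _ _
  simp only [koszul, e, mlieBracket_swap_apply (V := Y) (W := X), extend_apply_self, map_neg,
    neg_apply]
  ring

theorem leviCivita_metric {x : M} {Y Z : Π x : M, TangentSpace I x} (v : TangentSpace I x)
    (hY : MDiffAt (T% Y) x) (hZ : MDiffAt (T% Z) x) :
    d% (fun y ↦ g.val y (Y y) (Z y)) x v =
      g.val x (g.leviCivita Y x v) (Z x) + g.val x (Y x) (g.leviCivita Z x v) := by
  have hX := mdifferentiableAt_extend I E v
  have h := g.val_leviCivitaFun hX hY hZ
  have h' := g.val_leviCivitaFun hX hZ hY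
  simp only [extend_apply_self] at h h'
  rw [g.symm x (Y x)]
  simp only [leviCivita, h, h']
  have e : (fun y ↦ g.val y (Y y) (Z y)) = fun y ↦ g.val y (Z y) (Y y) := by
    ext y; exact g.symm _ _ _
  simp only [koszul, e, mlieBracket_swap_apply (V := Z) (W := Y), extend_apply_self, map_neg,
    neg_apply]
  ring


/-- `g` is Lorentzian: at every point its index, that is the largest dimension of a subspace on
which it is negative definite, is `1`. -/
def IsLorentzian : Prop :=
  ∀ x : M, IsGreatest {d : ℕ | ∃ W : Submodule ℝ (TangentSpace I x),
    Module.finrank ℝ W = d ∧ ∀ w ∈ W, w ≠ 0 → g.val x w w < 0} 1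

end MetricTensor

/-- A Lorentzian almost contact (`ε = -1`) or almost paracontact (`ε = 1`) structure `(φ, ξ, η)`
on `(M, g)`. -/
structure IsLorentzianAlmostContact (ε : ℝ) (g : MetricTensor I M)
    (φ : Π x : M, TangentSpace I x →L[ℝ] TangentSpace I x) (ξ : Π x : M, TangentSpace I x)
    (η : Π x : M, TangentSpace I x →L[ℝ] ℝ) : Prop where
  sign : ε = 1 ∨ ε = -1
  lorentzian : g.IsLorentzian
  contMDiff_phi : ContMDiff I (I.prod 𝓘(ℝ, E →L[ℝ] E)) ∞
    (fun x ↦ TotalSpace.mk' (E →L[ℝ] E)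
      (E := fun x : M ↦ TangentSpace I x →L[ℝ] TangentSpace I x) x (φ x))
  contMDiff_xi : CMDiff ∞ (T% ξ)
  contMDiff_eta : ContMDiff I (I.prod 𝓘(ℝ, E →L[ℝ] ℝ)) ∞
    (fun x ↦ TotalSpace.mk' (E →L[ℝ] ℝ) (E := fun x : M ↦ TangentSpace I x →L[ℝ] ℝ) x (η x))
  phi_phi (x : M) (v : TangentSpace I x) : φ x (φ x v) = ε • v + η x v • ξ x
  val_phi_phi (x : M) (v w : TangentSpace I x) :
    g.val x (φ x v) (φ x w) = g.val x v w + η x v * η x w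
  eta_eq (x : M) (v : TangentSpace I x) : η x v = ε * g.val x v (ξ x)
  eta_xi (x : M) : η x (ξ x) = -ε

/-- A Lorentzian Sasakian (`ε = -1`) or Lorentzian para-Sasakian (`ε = 1`) structure:
`(∇_X φ) Y = ε g(φ X, φ Y) ξ + η(Y) φ² X`, where `(∇_X φ) Y = ∇_X (φ Y) - φ (∇_X Y)`. -/
structure IsLorentzianSasakian (ε : ℝ) (g : MetricTensor I M)
    (φ : Π x : M, TangentSpace I x →L[ℝ] TangentSpace I x) (ξ : Π x : M, TangentSpace I x)
    (η : Π x : M, TangentSpace I x →L[ℝ] ℝ) : Prop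
    extends IsLorentzianAlmostContact ε g φ ξ η where
  nabla_phi (X Y : Π x : M, TangentSpace I x) (hX : CMDiff ∞ (T% X)) (hY : CMDiff ∞ (T% Y))
    (x : M) :
    g.leviCivita (fun y ↦ φ y (Y y)) x (X x) - φ x (g.leviCivita Y x (X x)) =
      (ε * g.val x (φ x (X x)) (φ x (Y x))) • ξ x + η x (Y x) • φ x (φ x (X x))

/-- A distribution on `M` is integrable, in the sense of Frobenius, if the Lie bracket of any two
smooth vector fields tangent to it is again tangent to it. -/
def IsIntegrable (D : Π x : M, Submodule ℝ (TangentSpace I x)) : Prop :=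
  ∀ X Y : Π x : M, TangentSpace I x, CMDiff ∞ (T% X) → CMDiff ∞ (T% Y) →
    (∀ x, X x ∈ D x) → (∀ x, Y x ∈ D x) → ∀ x, mlieBracket I X Y x ∈ D x

end Metric

section Submersion

variable {E : Type*} [NormedAddCommGroup E] [NormedSpace ℝ E] [FiniteDimensional ℝ E]
  {H : Type*} [TopologicalSpace H] {I : ModelWithCorners ℝ E H}
  {M : Type*} [TopologicalSpace M] [ChartedSpace H M] [IsManifold I ∞ M]
  {E' : Type*} [NormedAddCommGroup E'] [NormedSpace ℝ E'] [FiniteDimensional ℝ E']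
  {H' : Type*} [TopologicalSpace H'] {J : ModelWithCorners ℝ E' H'}
  {N : Type*} [TopologicalSpace N] [ChartedSpace H' N] [IsManifold J ∞ N]

/-- The pullback along `F : M → N` of a connection on `TN`, applied to a section `σ` of `F⁻¹TN`.
In the local trivialization of `TN` around `F x`, with constant frame `e_i` and `σ = ∑ σ^i e_i`, it
is `∇_v σ = ∑ (dσ^i(v) e_i + σ^i(x) ∇_{F_* v} e_i)`. -/
def pullbackCov (cov : CovariantDerivative J E' (TangentSpace J : N → Type _)) (F : M → N)
    (σ : Π x : M, TangentSpace J (F x)) (x : M) :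
    TangentSpace I x →L[ℝ] TangentSpace J (F x) :=
  let t := trivializationAt E' (TangentSpace J : N → Type _) (F x)
  let s : M → E' := fun y ↦ (t ⟨F y, σ y⟩).2
  t.symmL ℝ (F x) ∘L (d% s x) + cov (fun q ↦ t.symm q (s x)) (F x) ∘L mfderiv I J F x

/-- A semi-Riemannian submersion from `(M, gM)` onto `(N, gN)`. -/
structure SemiRiemannianSubmersion (gM : MetricTensor I M) (gN : MetricTensor J N) where
  /-- The underlying map. -/
  toFun : M → N
  contMDiff : ContMDiff I J ∞ toFun
  surjective : Function.Surjective toFun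
  surjective_mfderiv (x : M) : Function.Surjective (mfderiv I J toFun x)
  /-- The fibers are semi-Riemannian submanifolds. -/
  nondegenerate (x : M) (v : TangentSpace I x) : mfderiv I J toFun x v = 0 →
    (∀ w, mfderiv I J toFun x w = 0 → gM.val x v w = 0) → v = 0
  /-- The differential preserves scalar products of vectors normal to the fibers. -/
  isometry (x : M) (v w : TangentSpace I x) :
    (∀ u, mfderiv I J toFun x u = 0 → gM.val x v u = 0) →
    (∀ u, mfderiv I J toFun x u = 0 → gM.val x w u = 0) →
    gN.val (toFun x) (mfderiv I J toFun x v) (mfderiv I J toFun x w) = gM.val x v w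

namespace SemiRiemannianSubmersion

variable {gM : MetricTensor I M} {gN : MetricTensor J N} (F : SemiRiemannianSubmersion gM gN)

/-- The differential `F_*`. -/
def diff (x : M) : TangentSpace I x →L[ℝ] TangentSpace J (F.toFun x) := mfderiv I J F.toFun x

/-- The vertical distribution `ker F_*`. -/
def vertical (x : M) : Submodule ℝ (TangentSpace I x) := (F.diff x).ker

/-- The horizontal distribution `(ker F_*)^⊥`. -/
def horizontal (x : M) : Submodule ℝ (TangentSpace I x) where
  carrier := {v | ∀ u ∈ F.vertical x, gM.val x v u = 0}
  add_mem' hv hw u hu := by simp [hv u hu, hw u hu]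
  zero_mem' u _ := by simp
  smul_mem' c v hv u hu := by simp [hv u hu]

theorem isCompl (x : M) : IsCompl (F.vertical x) (F.horizontal x) := by
  have : FiniteDimensional ℝ (TangentSpace I x) := inferInstanceAs (FiniteDimensional ℝ E)
  let B : LinearMap.BilinForm ℝ (TangentSpace I x) :=
    (ContinuousLinearMap.coeLM ℝ).comp (gM.val x : TangentSpace I x →ₗ[ℝ] _)
  have hB : ∀ v w, B v w = gM.val x v w := fun _ _ ↦ rfl
  have h1 : B.IsRefl := fun v w h ↦ by rw [hB] at h ⊢; rw [gM.symm, h]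
  have h2 : Disjoint (F.vertical x) (B.orthogonal (F.vertical x)) := by
    rw [Submodule.disjoint_def]
    intro v hv hv'
    refine F.nondegenerate x v hv fun w hw ↦ ?_
    rw [gM.symm]
    exact LinearMap.BilinForm.mem_orthogonal_iff.1 hv' w hw
  have h3 := (LinearMap.BilinForm.isCompl_orthogonal_iff_disjoint h1).2 h2
  have h4 : B.orthogonal (F.vertical x) = F.horizontal x := by
    ext v
    simp only [LinearMap.BilinForm.mem_orthogonal_iff, horizontal, Submodule.mem_mk]
    exact forall₂_congr fun u _ ↦ by
      change gM.val x u v = 0 ↔ gM.val x v u = 0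
      rw [gM.symm]
  rwa [h4] at h3

/-- The projection `𝒱` onto the vertical distribution. -/
def ver (x : M) : TangentSpace I x →ₗ[ℝ] TangentSpace I x :=
  (F.vertical x).projection (F.horizontal x) (F.isCompl x)

/-- The projection `ℋ` onto the horizontal distribution. -/
def hor (x : M) : TangentSpace I x →ₗ[ℝ] TangentSpace I x :=
  (F.horizontal x).projection (F.vertical x) (F.isCompl x).symm

/-- The smooth vertical vector fields `Γ(ker F_*)`. -/
def verticalFields : Set (Π x : M, TangentSpace I x) :=
  {V | CMDiff ∞ (T% V) ∧ ∀ x, V x ∈ F.vertical x}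

/-- The smooth horizontal vector fields `Γ((ker F_*)^⊥)`. -/
def horizontalFields : Set (Π x : M, TangentSpace I x) :=
  {X | CMDiff ∞ (T% X) ∧ ∀ x, X x ∈ F.horizontal x}

/-- O'Neill's tensor `𝒜_X Y = 𝒱 ∇_{ℋ X} ℋ Y + ℋ ∇_{ℋ X} 𝒱 Y`. -/
def oneillA (X Y : Π x : M, TangentSpace I x) (x : M) : TangentSpace I x :=
  F.ver x (gM.leviCivita (fun y ↦ F.hor y (Y y)) x (F.hor x (X x))) +
    F.hor x (gM.leviCivita (fun y ↦ F.ver y (Y y)) x (F.hor x (X x)))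

/-- The second fundamental form `(∇F_*)(X, Y) = ∇^F_X (F_* Y) - F_* (∇_X Y)` of `F`, where `∇^F` is
the pullback of the Levi-Civita connection of `N`. -/
def secondFundamentalForm (X Y : Π x : M, TangentSpace I x) (x : M) :
    TangentSpace J (F.toFun x) :=
  pullbackCov gN.leviCivita F.toFun (fun y ↦ F.diff y (Y y)) x (X x) -
    F.diff x (gM.leviCivita Y x (X x))

/-- `F` is anti-invariant with respect to `φ`: `φ (ker F_*) ⊆ (ker F_*)^⊥`. -/
def IsAntiInvariant (φ : Π x : M, TangentSpace I x →L[ℝ] TangentSpace I x) : Prop :=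
  ∀ x, ∀ v ∈ F.vertical x, φ x v ∈ F.horizontal x

/-- The vertical part `B X` of `φ X`. -/
def B (φ : Π x : M, TangentSpace I x →L[ℝ] TangentSpace I x) (X : Π x : M, TangentSpace I x)
    (x : M) : TangentSpace I x :=
  F.ver x (φ x (X x))

/-- The horizontal part `C X` of `φ X`. For horizontal `X` it lies in the orthogonal complement `μ` of
`φ (ker F_*)` in `(ker F_*)^⊥` when `ξ` is horizontal. -/
def C (φ : Π x : M, TangentSpace I x →L[ℝ] TangentSpace I x) (X : Π x : M, TangentSpace I x)
    (x : M) : TangentSpace I x :=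
  F.hor x (φ x (X x))

end SemiRiemannianSubmersion

end Submersion

end LorentzianSubmersion

end

noncomputable section

namespace LorentzianSubmersion

open scoped Topology

section Metric

variable {E : Type*} [NormedAddCommGroup E] [NormedSpace ℝ E] [FiniteDimensional ℝ E]
  {H : Type*} [TopologicalSpace H] {I : ModelWithCorners ℝ E H}
  {M : Type*} [TopologicalSpace M] [ChartedSpace H M] [IsManifold I ∞ M]

/-- A family of functionals on a finite-dimensional space is smooth if all its evaluations are. -/
lemma contMDiffAt_dual_of_apply {f : M → E →L[ℝ] ℝ} {x₀ : M}
    (h : ∀ v : E, CMDiffAt ∞ (fun x ↦ f x v) x₀) : CMDiffAt ∞ f x₀ := by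
  let b := Module.finBasis ℝ E
  have e : f = fun x ↦ ∑ i, f x (b i) • LinearMap.toContinuousLinearMap (b.coord i) := by
    ext x v
    conv_lhs => rw [← b.sum_repr v, map_sum]
    simp [mul_comm]
  rw [e]
  exact contMDiffAt_finsetSum fun i _ ↦ (h (b i)).smul contMDiffAt_const

/-- Every tangent vector extends to a smooth vector field on the whole manifold. -/
lemma exists_contMDiff_extend [T2Space M] (x : M) (v : TangentSpace I x) :
    ∃ Z : Π x : M, TangentSpace I x, CMDiff ∞ (T% Z) ∧ Z x = v := by
  obtain ⟨s, hs, hZ⟩ :=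
    FiberBundle.exists_contMDiffOn_extend (k := ∞) I E (V := (TangentSpace I : M → Type _)) v
  obtain ⟨u, hus, hu, hxu⟩ := mem_nhds_iff.1 hs
  obtain ⟨f, -, hf⟩ := (SmoothBumpFunction.nhds_basis_tsupport (I := I) x).mem_iff.1
    (hu.mem_nhds hxu)
  exact ⟨(f : M → ℝ) • extend E v,
    ContMDiffOn.smul_section_of_tsupport f.contMDiff.contMDiffOn hu hf (hZ.mono hus),
    by simp⟩

namespace MetricTensor

variable (g : MetricTensor I M)

/-- A vector field is smooth if its scalar products with smooth fields are. -/
lemma contMDiffAt_of_val {x₀ : M} {Z : Π x : M, TangentSpace I x}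
    (h : ∀ W : Π x : M, TangentSpace I x, CMDiffAt ∞ (T% W) x₀ →
      CMDiffAt ∞ (fun x ↦ g.val x (Z x) (W x)) x₀) :
    CMDiffAt ∞ (T% Z) x₀ := by
  have : CompleteSpace E := FiniteDimensional.complete ℝ E
  let t := trivializationAt E (TangentSpace I : M → Type _) x₀
  have ht : ∀ᶠ x in 𝓝 x₀, x ∈ t.baseSet :=
    t.open_baseSet.mem_nhds (FiberBundle.mem_baseSet_trivializationAt' x₀)
  let G : M → E →L[ℝ] E →L[ℝ] ℝ := fun x ↦
    ContinuousLinearMap.inCoordinates E (TangentSpace I : M → Type _) (E →L[ℝ] ℝ)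
      (fun x : M ↦ TangentSpace I x →L[ℝ] ℝ) x₀ x x₀ x (g.val x)
  have hG : CMDiffAt ∞ G x₀ := ((contMDiffAt_hom_bundle _).1 (g.contMDiff x₀)).2
  have hGa : ∀ x ∈ t.baseSet, ∀ v w : E, G x v w = g.val x (t.symm x v) (t.symm x w) := by
    intro x hx v w
    have := inCoordinates_apply_eq₂ (F₁ := E) (F₂ := E) (F₃ := ℝ)
      (E₁ := (TangentSpace I : M → Type _)) (E₂ := (TangentSpace I : M → Type _))
      (E₃ := Bundle.Trivial M ℝ) (x₀ := x₀) (x := x) (ϕ := g.val x) (v := v) (w := w) hx hx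
      (by simp)
    simpa using this
  have hGi : ∀ x ∈ t.baseSet, (G x).IsInvertible := by
    intro x hx
    have hinj : Function.Injective (G x : E →ₗ[ℝ] E →L[ℝ] ℝ) := by
      refine (injective_iff_map_eq_zero _).2 fun v hv ↦ ?_
      have h0 : t.symm x v = 0 := g.nondegenerate x _ fun w ↦ by
        have := hGa x hx v (t ⟨x, w⟩).2
        rw [t.symm_apply_apply_mk hx] at this
        rw [← this]
        exact congr($hv _)
      have h1 := t.apply_mk_symm hx v
      rw [h0] at h1
      exact congr(($h1).2).symm.trans (t.linear ℝ hx).map_zero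
    let e := (LinearEquiv.ofInjectiveOfFinrankEq _ hinj (by
      rw [← (LinearMap.toContinuousLinearMap (𝕜 := ℝ) (E := E) (F' := ℝ)).finrank_eq]
      exact Subspace.dual_finrank_eq.symm)).toContinuousLinearEquiv
    exact ⟨e, by ext; rfl⟩
  rw [contMDiffAt_section]
  have hGZ : CMDiffAt ∞ (fun x ↦ G x (t ⟨x, Z x⟩).2) x₀ := by
    refine contMDiffAt_dual_of_apply fun v ↦ ?_
    let w : TangentSpace I x₀ := t.symm x₀ v
    refine (h (extend E w) (contMDiffAt_extend I E w)).congr_of_eventuallyEq ?_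
    filter_upwards [ht] with x hx
    rw [hGa x hx, t.symm_apply_apply_mk hx]
    congr 1
    have hx₀ : x₀ ∈ t.baseSet := FiberBundle.mem_baseSet_trivializationAt' x₀
    simp [extend, w, t, t.apply_mk_symm hx₀]
  have hinv : CMDiffAt ∞ (fun x ↦ (G x).inverse) x₀ :=
    ((hGi x₀ (FiberBundle.mem_baseSet_trivializationAt' x₀)).contDiffAt_map_inverse
      (n := ∞)).contMDiffAt.comp x₀ hG
  refine (hinv.clm_apply hGZ).congr_of_eventuallyEq ?_
  filter_upwards [ht] with x hx
  exact ((hGi x hx).inverse_apply_self _).symm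

end MetricTensor

end Metric

section AlmostContact

variable {E : Type*} [NormedAddCommGroup E] [NormedSpace ℝ E] [FiniteDimensional ℝ E]
  {H : Type*} [TopologicalSpace H] {I : ModelWithCorners ℝ E H}
  {M : Type*} [TopologicalSpace M] [ChartedSpace H M] [IsManifold I ∞ M]
  {ε : ℝ} {g : MetricTensor I M}
  {φ : Π x : M, TangentSpace I x →L[ℝ] TangentSpace I x} {ξ : Π x : M, TangentSpace I x}
  {η : Π x : M, TangentSpace I x →L[ℝ] ℝ}

namespace IsLorentzianAlmostContact

variable (h : IsLorentzianAlmostContact ε g φ ξ η)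
include h

lemma sign_mul_sign : ε * ε = 1 := by
  rcases h.sign with rfl | rfl <;> norm_num

lemma sign_ne_zero : ε ≠ 0 := fun h0 ↦ by simpa [h0] using h.sign_mul_sign

lemma xi_ne_zero (x : M) : ξ x ≠ 0 := fun h0 ↦ h.sign_ne_zero (by simpa [h0] using h.eta_xi x)

lemma phi_xi (x : M) : φ x (ξ x) = 0 := by
  have h1 : φ x (φ x (ξ x)) = 0 := by rw [h.phi_phi, h.eta_xi, ← add_smul]; simp
  have h2 := h.phi_phi x (φ x (ξ x))
  have h3 : η x (φ x (ξ x)) • φ x (ξ x) = 0 := by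
    have := congr(φ x $h2)
    simpa [h1] using this.symm
  rcases smul_eq_zero.1 h3 with h4 | h4
  · rw [h1, h4, map_zero, zero_smul, add_zero] at h2
    exact (smul_eq_zero.1 h2.symm).resolve_left h.sign_ne_zero
  · exact h4

lemma eta_phi (x : M) (v : TangentSpace I x) : η x (φ x v) = 0 := by
  have h1 := h.phi_phi x (φ x v)
  rw [h.phi_phi x v, map_add, map_smul, map_smul, h.phi_xi, smul_zero, add_zero,
    left_eq_add] at h1
  exact (smul_eq_zero.1 h1).resolve_right (h.xi_ne_zero x)

lemma val_xi (x : M) (v : TangentSpace I x) : g.val x v (ξ x) = ε * η x v := by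
  rw [h.eta_eq, ← mul_assoc, h.sign_mul_sign, one_mul]

/-- `φ` is self-adjoint up to the sign `ε`. -/
lemma val_phi (x : M) (v w : TangentSpace I x) : g.val x v (φ x w) = ε * g.val x (φ x v) w := by
  have := h.val_phi_phi x v (φ x w)
  rw [h.phi_phi, h.eta_phi, mul_zero, add_zero, map_add, map_smul, map_smul, h.val_xi,
    h.eta_phi] at this
  simpa using this.symm

lemma contMDiff_phi_apply {X : Π x : M, TangentSpace I x} (hX : CMDiff ∞ (T% X)) :
    CMDiff ∞ (T% (fun x ↦ φ x (X x))) :=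
  h.contMDiff_phi.clm_bundle_apply hX

end IsLorentzianAlmostContact

/-- `∇_X ξ = ε φ X`. -/
lemma IsLorentzianSasakian.leviCivita_xi (h : IsLorentzianSasakian ε g φ ξ η)
    {X : Π x : M, TangentSpace I x} (hX : CMDiff ∞ (T% X)) (x : M) :
    g.leviCivita ξ x (X x) = ε • φ x (X x) := by
  have hd : MDiffAt (T% ξ) x := (h.contMDiff_xi x).mdifferentiableAt (by simp)
  have h1 := h.nabla_phi X ξ hX h.contMDiff_xi x
  have e : (fun y ↦ φ y (ξ y)) = 0 := by ext y; exact h.phi_xi y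
  rw [e, CovariantDerivative.zero, h.phi_xi, h.eta_xi] at h1
  have h2 : η x (g.leviCivita ξ x (X x)) = 0 := by
    have h3 := g.leviCivita_metric (X x) hd hd
    have e' : (fun y ↦ g.val y (ξ y) (ξ y)) = fun _ ↦ ε * -ε := by
      ext y; rw [h.val_xi, h.eta_xi]
    rw [e', mvfderiv_const, g.symm x (ξ x), zero_apply] at h3
    rw [h.eta_eq, show g.val x (g.leviCivita ξ x (X x)) (ξ x) = 0 by linarith, mul_zero]
  have h4 : φ x (g.leviCivita ξ x (X x)) = ε • φ x (φ x (X x)) := by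
    simpa using h1
  have h5 := congr(φ x $h4)
  rw [h.phi_phi, h2, zero_smul, add_zero, map_smul, h.phi_phi x (φ x (X x)), h.eta_phi, zero_smul,
    add_zero] at h5
  exact smul_right_injective _ h.sign_ne_zero h5

end AlmostContact

section Submersion

variable {E : Type*} [NormedAddCommGroup E] [NormedSpace ℝ E] [FiniteDimensional ℝ E]
  {H : Type*} [TopologicalSpace H] {I : ModelWithCorners ℝ E H}
  {M : Type*} [TopologicalSpace M] [ChartedSpace H M] [IsManifold I ∞ M]
  {E' : Type*} [NormedAddCommGroup E'] [NormedSpace ℝ E'] [FiniteDimensional ℝ E']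
  {H' : Type*} [TopologicalSpace H'] {J : ModelWithCorners ℝ E' H'}
  {N : Type*} [TopologicalSpace N] [ChartedSpace H' N] [IsManifold J ∞ N]

/-- The pullback connection annihilates the zero section. -/
lemma pullbackCov_zero (cov : CovariantDerivative J E' (TangentSpace J : N → Type _)) (F : M → N)
    (hF : Continuous F) (x : M) (v : TangentSpace I x) :
    pullbackCov (I := I) cov F (fun _ ↦ 0) x v = 0 := by
  let t := trivializationAt E' (TangentSpace J : N → Type _) (F x)
  have hz : ∀ q ∈ t.baseSet, (t ⟨q, (0 : TangentSpace J q)⟩).2 = 0 := fun q hq ↦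
    (t.linear ℝ hq).map_zero
  have hx : F x ∈ t.baseSet := FiberBundle.mem_baseSet_trivializationAt' (F x)
  have h1 : (fun y ↦ (t ⟨F y, (0 : TangentSpace J (F y))⟩).2) =ᶠ[𝓝 x] fun _ ↦ (0 : E') := by
    filter_upwards [hF.continuousAt.preimage_mem_nhds (t.open_baseSet.mem_nhds hx)] with y hy
    exact hz _ hy
  have h2 : cov (extend E' (0 : TangentSpace J (F x))) (F x) = 0 := by
    rw [cov.isCovariantDerivativeOnUniv.congr_of_eventuallyEq (mdifferentiableAt_extend J E' _)
      (σ' := 0) (mdifferentiable_zeroSection ℝ _ _) Filter.univ_mem]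
    · exact congr_fun cov.zero (F x)
    · filter_upwards [t.open_baseSet.mem_nhds hx] with q hq
      change t.symm q (t ⟨F x, (0 : TangentSpace J (F x))⟩).2 = 0
      rw [hz _ hx, ← hz _ hq, t.symm_apply_apply_mk hq]
  have h3 : d% (fun y ↦ (t ⟨F y, (0 : TangentSpace J (F y))⟩).2) x = 0 := by
    have h4 : mfderiv I 𝓘(ℝ, E') (fun y ↦ (t ⟨F y, (0 : TangentSpace J (F y))⟩).2) x = 0 :=
      h1.mfderiv_eq.trans mfderiv_const
    rw [mvfderiv, h4]
    exact ContinuousLinearMap.comp_zero _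
  change t.symmL ℝ (F x) (d% (fun y ↦ (t ⟨F y, (0 : TangentSpace J (F y))⟩).2) x v) +
    cov (extend E' (0 : TangentSpace J (F x))) (F x) (mfderiv I J F x v) = 0
  rw [h2, h3]
  simp

namespace SemiRiemannianSubmersion

variable {gM : MetricTensor I M} {gN : MetricTensor J N} (F : SemiRiemannianSubmersion gM gN)

lemma ver_mem (x : M) (v : TangentSpace I x) : F.ver x v ∈ F.vertical x :=
  Submodule.projection_apply_mem _ v

lemma hor_mem (x : M) (v : TangentSpace I x) : F.hor x v ∈ F.horizontal x :=
  Submodule.projection_apply_mem _ v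

lemma ver_add_hor (x : M) (v : TangentSpace I x) : F.ver x v + F.hor x v = v :=
  Submodule.projection_add_projection_eq_self _ v

variable {F} {x : M} {u v w : TangentSpace I x}

lemma ver_of_vertical (hv : v ∈ F.vertical x) : F.ver x v = v :=
  Submodule.projection_apply_of_mem_left _ hv

lemma hor_of_horizontal (hv : v ∈ F.horizontal x) : F.hor x v = v :=
  Submodule.projection_apply_of_mem_left _ hv

lemma ver_of_horizontal (hv : v ∈ F.horizontal x) : F.ver x v = 0 :=
  (Submodule.projection_apply_eq_zero_iff _).2 hv

lemma hor_of_vertical (hv : v ∈ F.vertical x) : F.hor x v = 0 :=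
  (Submodule.projection_apply_eq_zero_iff _).2 hv

lemma diff_of_vertical (hv : v ∈ F.vertical x) : F.diff x v = 0 := hv

lemma val_horizontal_vertical (hu : u ∈ F.horizontal x) (hv : v ∈ F.vertical x) :
    gM.val x u v = 0 := hu v hv

lemma val_vertical_horizontal (hv : v ∈ F.vertical x) (hu : u ∈ F.horizontal x) :
    gM.val x v u = 0 := by rw [gM.symm]; exact hu v hv

lemma val_hor_of_horizontal (hw : w ∈ F.horizontal x) : gM.val x (F.hor x v) w = gM.val x v w := by
  conv_rhs => rw [← F.ver_add_hor x v]
  rw [map_add, add_apply, val_vertical_horizontal (F.ver_mem x v) hw, zero_add]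

lemma diff_hor : F.diff x (F.hor x v) = F.diff x v := by
  conv_rhs => rw [← F.ver_add_hor x v]
  rw [map_add, diff_of_vertical (F.ver_mem x v), zero_add]

lemma val_diff_diff : gN.val (F.toFun x) (F.diff x v) (F.diff x w) = gM.val x (F.hor x v) w := by
  rw [← diff_hor (v := v), ← diff_hor (v := w)]
  refine (F.isometry x _ _ (F.hor_mem x v) (F.hor_mem x w)).trans ?_
  conv_rhs => rw [← F.ver_add_hor x w]
  rw [map_add, val_horizontal_vertical (F.hor_mem x v) (F.ver_mem x w), zero_add]

variable (F)

lemma contMDiffAt_diff {X : Π x : M, TangentSpace I x} {x : M} (hX : CMDiffAt ∞ (T% X) x) :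
    ContMDiffAt I J.tangent ∞
      (fun y ↦ (⟨F.toFun y, F.diff y (X y)⟩ : TangentBundle J N)) x :=
  (F.contMDiff.contMDiff_tangentMap (m := ∞) (by simp)).contMDiffAt.comp x hX

/-- The horizontal part of a smooth field is smooth. -/
lemma contMDiff_hor {X : Π x : M, TangentSpace I x} (hX : CMDiff ∞ (T% X)) :
    CMDiff ∞ (T% (fun x ↦ F.hor x (X x))) := by
  refine fun x ↦ gM.contMDiffAt_of_val fun W hW ↦ ?_
  simp_rw [← val_diff_diff]
  have h := ContMDiffAt.clm_bundle_apply₂ (F₁ := E') (F₂ := E') (F₃ := ℝ)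
    (E₃ := Bundle.Trivial N ℝ) (b := F.toFun) ((gN.contMDiff _).comp x (F.contMDiff x))
    (F.contMDiffAt_diff (hX x)) (F.contMDiffAt_diff hW)
  exact (contMDiffAt_totalSpace.1 h).2

/-- The vertical part of a smooth field is smooth. -/
lemma contMDiff_ver {X : Π x : M, TangentSpace I x} (hX : CMDiff ∞ (T% X)) :
    CMDiff ∞ (T% (fun x ↦ F.ver x (X x))) := by
  have e : ∀ x, F.ver x (X x) = X x - F.hor x (X x) := fun x ↦
    eq_sub_of_add_eq (F.ver_add_hor x (X x))
  simp_rw [e]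
  exact hX.sub_section (F.contMDiff_hor hX)

/-- Every vertical vector extends to a smooth vertical field. -/
lemma exists_verticalFields_extend [T2Space M] (hv : v ∈ F.vertical x) :
    ∃ V ∈ F.verticalFields, V x = v := by
  obtain ⟨Z, hZ, rfl⟩ := exists_contMDiff_extend (I := I) x v
  exact ⟨fun y ↦ F.ver y (Z y), ⟨F.contMDiff_ver hZ, fun y ↦ F.ver_mem y _⟩, ver_of_vertical hv⟩

/-- On fields that are vertical, the second fundamental form is `-F_* ∇`. -/
lemma secondFundamentalForm_of_vertical (X : Π x : M, TangentSpace I x)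
    {V : Π x : M, TangentSpace I x} (hV : ∀ x, V x ∈ F.vertical x) (x : M) :
    F.secondFundamentalForm X V x = - F.diff x (gM.leviCivita V x (X x)) := by
  have e : (fun y ↦ F.diff y (V y)) = fun y ↦ (0 : TangentSpace J (F.toFun y)) := by
    ext y; exact hV y
  rw [secondFundamentalForm, e, pullbackCov_zero _ _ F.contMDiff.continuous, zero_sub]

lemma oneillA_of_vertical {X V : Π x : M, TangentSpace I x}
    (hX : ∀ x, X x ∈ F.horizontal x) (hV : ∀ x, V x ∈ F.vertical x) (x : M) :
    F.oneillA X V x = F.hor x (gM.leviCivita V x (X x)) := by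
  have e : (fun y ↦ F.hor y (V y)) = 0 := by ext y; exact hor_of_vertical (hV y)
  have e' : (fun y ↦ F.ver y (V y)) = V := by ext y; exact ver_of_vertical (hV y)
  rw [oneillA, e, e', hor_of_horizontal (hX x), CovariantDerivative.zero]
  simp

lemma oneillA_of_horizontal {X Y : Π x : M, TangentSpace I x}
    (hX : ∀ x, X x ∈ F.horizontal x) (hY : ∀ x, Y x ∈ F.horizontal x) (x : M) :
    F.oneillA X Y x = F.ver x (gM.leviCivita Y x (X x)) := by
  have e : (fun y ↦ F.ver y (Y y)) = 0 := by ext y; exact ver_of_horizontal (hY y)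
  have e' : (fun y ↦ F.hor y (Y y)) = Y := by ext y; exact hor_of_horizontal (hY y)
  rw [oneillA, e, e', hor_of_horizontal (hX x), CovariantDerivative.zero]
  simp

end SemiRiemannianSubmersion

end Submersion

namespace SemiRiemannianSubmersion

variable {E : Type*} [NormedAddCommGroup E] [NormedSpace ℝ E] [FiniteDimensional ℝ E]
  {H : Type*} [TopologicalSpace H] {I : ModelWithCorners ℝ E H}
  {M : Type*} [TopologicalSpace M] [ChartedSpace H M] [IsManifold I ∞ M]
  {E' : Type*} [NormedAddCommGroup E'] [NormedSpace ℝ E'] [FiniteDimensional ℝ E']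
  {H' : Type*} [TopologicalSpace H'] {J : ModelWithCorners ℝ E' H'}
  {N : Type*} [TopologicalSpace N] [ChartedSpace H' N] [IsManifold J ∞ N]
  {gM : MetricTensor I M} {gN : MetricTensor J N} (F : SemiRiemannianSubmersion gM gN)
  {ε : ℝ} {φ : Π x : M, TangentSpace I x →L[ℝ] TangentSpace I x} {ξ : Π x : M, TangentSpace I x}
  {η : Π x : M, TangentSpace I x →L[ℝ] ℝ}

/-- The horizontal distribution is integrable if and only if brackets of horizontal fields are
orthogonal to all vertical fields. -/
lemma isIntegrable_horizontal_iff [T2Space M] :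
    IsIntegrable F.horizontal ↔ ∀ X ∈ F.horizontalFields, ∀ Y ∈ F.horizontalFields,
      ∀ V ∈ F.verticalFields, ∀ x : M, gM.val x (mlieBracket I X Y x) (V x) = 0 := by
  constructor
  · intro h X hX Y hY V hV x
    exact h X Y hX.1 hY.1 hX.2 hY.2 x _ (hV.2 x)
  · intro h X Y hX hY hX' hY' x v hv
    obtain ⟨V, hV, rfl⟩ := F.exists_verticalFields_extend hv
    exact h X ⟨hX, hX'⟩ Y ⟨hY, hY'⟩ V hV x

variable (hM : IsLorentzianSasakian ε gM φ ξ η) (hF : F.IsAntiInvariant φ)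
  (hξ : ∀ x, ξ x ∈ F.horizontal x)
include hM hF hξ

omit hF in
lemma eta_of_vertical {x : M} {v : TangentSpace I x} (hv : v ∈ F.vertical x) : η x v = 0 := by
  rw [hM.eta_eq, val_vertical_horizontal hv (hξ x), mul_zero]

/-- `C Y` is orthogonal to `φ (ker F_*)`. -/
lemma val_C_phi_of_vertical {Y : Π x : M, TangentSpace I x} (hY : ∀ x, Y x ∈ F.horizontal x)
    {x : M} {v : TangentSpace I x} (hv : v ∈ F.vertical x) :
    gM.val x (F.C φ Y x) (φ x v) = 0 := by
  rw [C, val_hor_of_horizontal (hF x v hv), hM.val_phi_phi, hY x v hv,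
    F.eta_of_vertical hM hξ hv, mul_zero, add_zero]

omit hF in
/-- `C Y` is orthogonal to `ξ`. -/
lemma val_C_xi (Y : Π x : M, TangentSpace I x) (x : M) : gM.val x (F.C φ Y x) (ξ x) = 0 := by
  rw [C, val_hor_of_horizontal (hξ x), hM.val_xi, hM.eta_phi, mul_zero]

/-- `g(∇_X (C Y), φ V) = -g(C Y, φ (𝒜_X V))`. -/
lemma val_leviCivita_C {X Y V : Π x : M, TangentSpace I x} (hX : X ∈ F.horizontalFields)
    (hY : Y ∈ F.horizontalFields) (hV : V ∈ F.verticalFields) (x : M) :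
    gM.val x (gM.leviCivita (F.C φ Y) x (X x)) (φ x (V x)) =
      - gM.val x (F.C φ Y x) (φ x (F.oneillA X V x)) := by
  have hC : MDiffAt (T% (F.C φ Y)) x :=
    (F.contMDiff_hor (hM.contMDiff_phi_apply hY.1) x).mdifferentiableAt (by simp)
  have hφV : MDiffAt (T% (fun y ↦ φ y (V y))) x :=
    (hM.contMDiff_phi_apply hV.1 x).mdifferentiableAt (by simp)
  have h1 := gM.leviCivita_metric (X x) hC hφV
  have e : (fun y ↦ gM.val y (F.C φ Y y) (φ y (V y))) = fun _ ↦ 0 := by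
    ext y; exact F.val_C_phi_of_vertical hM hF hξ hY.2 (hV.2 y)
  rw [e, mvfderiv_const, zero_apply] at h1
  have h2 := hM.nabla_phi X V hX.1 hV.1 x
  rw [F.eta_of_vertical hM hξ (hV.2 x), zero_smul, add_zero] at h2
  rw [sub_eq_iff_eq_add.1 h2, map_add, map_smul, F.val_C_xi hM hξ, smul_zero, zero_add,
    ← F.ver_add_hor x (gM.leviCivita V x (X x)), map_add, map_add,
    F.val_C_phi_of_vertical hM hF hξ hY.2 (F.ver_mem x _), zero_add,
    ← F.oneillA_of_vertical hX.2 hV.2] at h1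
  linarith

/-- `g(φ ∇_X Y, φ V) = g(∇_X (B Y), φ V) - g(C Y, φ (𝒜_X V)) - ε η(Y) g(X, φ V)`. -/
lemma val_phi_leviCivita {X Y V : Π x : M, TangentSpace I x} (hX : X ∈ F.horizontalFields)
    (hY : Y ∈ F.horizontalFields) (hV : V ∈ F.verticalFields) (x : M) :
    gM.val x (φ x (gM.leviCivita Y x (X x))) (φ x (V x)) =
      gM.val x (gM.leviCivita (F.B φ Y) x (X x)) (φ x (V x))
        - gM.val x (F.C φ Y x) (φ x (F.oneillA X V x))
        - ε * gM.val x (X x) (φ x (V x)) * η x (Y x) := by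
  have hφY := hM.contMDiff_phi_apply hY.1
  have hB : MDiffAt (T% (F.B φ Y)) x := (F.contMDiff_ver hφY x).mdifferentiableAt (by simp)
  have hC : MDiffAt (T% (F.C φ Y)) x := (F.contMDiff_hor hφY x).mdifferentiableAt (by simp)
  have e : (fun y ↦ φ y (Y y)) = F.B φ Y + F.C φ Y := by
    ext y; exact (F.ver_add_hor y _).symm
  have h1 := hM.nabla_phi X Y hX.1 hY.1 x
  rw [e, gM.leviCivita.isCovariantDerivativeOnUniv.add hB hC, add_apply] at h1
  rw [← sub_eq_iff_comm.1 h1]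
  have h2 := F.val_leviCivita_C hM hF hξ hX hY hV x
  have h3 : gM.val x (ξ x) (φ x (V x)) = 0 := by rw [gM.symm, hM.val_xi, hM.eta_phi, mul_zero]
  simp only [hM.phi_phi x (X x), map_sub, map_add, map_smul, sub_apply, add_apply, smul_apply,
    smul_eq_mul, h2, h3]
  ring

/-- The vertical part of the bracket of horizontal fields. -/
lemma val_mlieBracket {X Y V : Π x : M, TangentSpace I x} (hX : X ∈ F.horizontalFields)
    (hY : Y ∈ F.horizontalFields) (hV : V ∈ F.verticalFields) (x : M) :
    gM.val x (mlieBracket I X Y x) (V x) =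
      gM.val x (gM.leviCivita (F.B φ Y) x (X x)) (φ x (V x))
        - gM.val x (gM.leviCivita (F.B φ X) x (Y x)) (φ x (V x))
        - (- gM.val x (F.C φ X x) (φ x (F.oneillA Y V x))
            + gM.val x (F.C φ Y x) (φ x (F.oneillA X V x))
            + ε * gM.val x (X x) (φ x (V x)) * η x (Y x)
            - ε * gM.val x (Y x) (φ x (V x)) * η x (X x)) := by
  have h1 := hM.val_phi_phi x (mlieBracket I X Y x) (V x)
  rw [F.eta_of_vertical hM hξ (hV.2 x), mul_zero, add_zero] at h1
  rw [← h1, ← gM.leviCivita_torsionFree ((hX.1 x).mdifferentiableAt (by simp))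
    ((hY.1 x).mdifferentiableAt (by simp)), map_sub, map_sub, sub_apply,
    F.val_phi_leviCivita hM hF hξ hX hY hV, F.val_phi_leviCivita hM hF hξ hY hX hV]
  ring

omit hM hξ in
lemma val_secondFundamentalForm_B (X Y : Π x : M, TangentSpace I x) {V : Π x : M, TangentSpace I x}
    (hV : V ∈ F.verticalFields) (x : M) :
    gN.val (F.toFun x) (F.secondFundamentalForm X (F.B φ Y) x) (F.diff x (φ x (V x))) =
      - gM.val x (gM.leviCivita (F.B φ Y) x (X x)) (φ x (V x)) := by
  rw [F.secondFundamentalForm_of_vertical X (V := F.B φ Y) fun y ↦ F.ver_mem y _, map_neg, neg_apply,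
    val_diff_diff, val_hor_of_horizontal (hF x _ (hV.2 x))]

/-- `ε g(𝒜_X 𝒜_Y ξ, φ V) = g(∇_X (B Y), φ V)`. -/
lemma val_oneillA_oneillA_xi {X Y V : Π x : M, TangentSpace I x} (hX : X ∈ F.horizontalFields)
    (hY : Y ∈ F.horizontalFields) (hV : V ∈ F.verticalFields) (x : M) :
    ε * gM.val x (F.oneillA X (F.oneillA Y ξ) x) (φ x (V x)) =
      gM.val x (gM.leviCivita (F.B φ Y) x (X x)) (φ x (V x)) := by
  have e : F.oneillA Y ξ = ε • F.B φ Y := by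
    ext y
    rw [F.oneillA_of_horizontal hY.2 hξ, hM.leviCivita_xi hY.1, map_smul]
    rfl
  have hB : MDiffAt (T% (F.B φ Y)) x :=
    (F.contMDiff_ver (hM.contMDiff_phi_apply hY.1) x).mdifferentiableAt (by simp)
  rw [e, F.oneillA_of_vertical (V := ε • F.B φ Y) hX.2 fun y ↦ (F.vertical y).smul_mem ε (F.ver_mem y _),
    val_hor_of_horizontal (hF x _ (hV.2 x)),
    gM.leviCivita.isCovariantDerivativeOnUniv.smul_const ε hB, smul_apply, map_smul, smul_apply,
    smul_eq_mul, ← mul_assoc, hM.sign_mul_sign, one_mul]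

end SemiRiemannianSubmersion

end LorentzianSubmersion

end

theorem mainTheorem6 {n k : ℕ}
    {M : Type*} [TopologicalSpace M] [T2Space M] [SecondCountableTopology M]
    [ChartedSpace (EuclideanSpace ℝ (Fin (2 * n + 1))) M] [IsManifold (𝓡 (2 * n + 1)) ∞ M]
    {N : Type*} [TopologicalSpace N] [T2Space N] [SecondCountableTopology N]
    [ChartedSpace (EuclideanSpace ℝ (Fin k)) N] [IsManifold (𝓡 k) ∞ N]
    {gM : LorentzianSubmersion.MetricTensor (𝓡 (2 * n + 1)) M}
    {gN : LorentzianSubmersion.MetricTensor (𝓡 k) N}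
    {ε : ℝ}
    {φ : Π x : M, TangentSpace (𝓡 (2 * n + 1)) x →L[ℝ] TangentSpace (𝓡 (2 * n + 1)) x}
    {ξ : Π x : M, TangentSpace (𝓡 (2 * n + 1)) x}
    {η : Π x : M, TangentSpace (𝓡 (2 * n + 1)) x →L[ℝ] ℝ}
    (hM : LorentzianSubmersion.IsLorentzianSasakian ε gM φ ξ η)
    (hN : gN.IsLorentzian)
    (F : LorentzianSubmersion.SemiRiemannianSubmersion gM gN)
    (hF : F.IsAntiInvariant φ)
    (hξ : ∀ x, ξ x ∈ F.horizontal x) :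
    List.TFAE [
      LorentzianSubmersion.IsIntegrable F.horizontal,
      ∀ X ∈ F.horizontalFields, ∀ Y ∈ F.horizontalFields, ∀ V ∈ F.verticalFields, ∀ x : M,
        gN.val (F.toFun x) (F.secondFundamentalForm Y (F.B φ X) x) (F.diff x (φ x (V x))) =
          gN.val (F.toFun x) (F.secondFundamentalForm X (F.B φ Y) x) (F.diff x (φ x (V x)))
            - gM.val x (F.C φ X x) (φ x (F.oneillA Y V x))
            + gM.val x (F.C φ Y x) (φ x (F.oneillA X V x))
            + ε * gM.val x (X x) (φ x (V x)) * η x (Y x)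
            - ε * gM.val x (Y x) (φ x (V x)) * η x (X x),
      ∀ X ∈ F.horizontalFields, ∀ Y ∈ F.horizontalFields, ∀ V ∈ F.verticalFields, ∀ x : M,
        ε * gM.val x (F.oneillA X (F.oneillA Y ξ) x - F.oneillA Y (F.oneillA X ξ) x)
            (φ x (V x)) =
          - gM.val x (F.C φ X x) (φ x (F.oneillA Y V x))
            + gM.val x (F.C φ Y x) (φ x (F.oneillA X V x))
            + ε * gM.val x (X x) (φ x (V x)) * η x (Y x)
            - ε * gM.val x (Y x) (φ x (V x)) * η x (X x)] := by
  have key := fun X hX Y hY V hV x ↦ F.val_mlieBracket hM hF hξ (X := X) (Y := Y) (V := V) hX hY hV x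
  rw [F.isIntegrable_horizontal_iff]
  tfae_have 1 ↔ 2 := by
    refine forall₂_congr fun X hX ↦ forall₂_congr fun Y hY ↦ forall₂_congr fun V hV ↦
      forall_congr' fun x ↦ ?_
    rw [key X hX Y hY V hV x, F.val_secondFundamentalForm_B hF Y X hV,
      F.val_secondFundamentalForm_B hF X Y hV]
    constructor <;> intro h <;> linarith
  tfae_have 1 ↔ 3 := by
    refine forall₂_congr fun X hX ↦ forall₂_congr fun Y hY ↦ forall₂_congr fun V hV ↦
      forall_congr' fun x ↦ ?_
    rw [key X hX Y hY V hV x, map_sub, sub_apply, mul_sub,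
      F.val_oneillA_oneillA_xi hM hF hξ hX hY hV, F.val_oneillA_oneillA_xi hM hF hξ hY hX hV,
      sub_eq_zero]
  tfae_finish
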